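/- Let $d\in\mathbb N$ and let $\{\alpha_k\}_{k\in\mathbb N}$ be a sequence of positive real numbers converging to zero with $\alpha_k\in\Omega(1/k)$. For each $k\in\mathbb N$ let $g(k,\cdot):\mathbb R^d\to\mathbb R^d$ be a $C^1$ map whose differential $D_{\vec x}g(k,\vec x)$ is invertible for Lebesgue-almost every $\vec x$ (for instance, a local diffeomorphism), and consider the system $\vec x_{k+1}=g(k,\vec x_k)$. Let $\mathcal A^*$ be the set of the points $\vec x^*$ such that $g(k,\vec x^*)=\vec x^*$ for all $k\in\mathbb N$ and such that, for all $k\in\mathbb N$, the matrix $D_{\vec x}g(k,\vec x^*)$ has an eigenvalue of absolute value greater than one. Suppose that for every $\vec x^*\in\mathcal A^*$: 1. there is a real diagonalizable $d\times d$ matrix $G$ with at least one negative eigenvalue such that $D_{\vec x}g(k,\vec x^*)=I-\alpha_kG$ for all $k\in\mathbb N$; 2. the Taylor remainder $\theta(k,\vec x)=g(k,\vec x)-g(k,\vec x^*)-D_{\vec x}g(k,\vec x^*)(\vec x-\vec x^*)$ has the property that for every $\epsilon>0$ there is $\delta>0$ such that $\|\theta(k,\vec u_1)-\theta(k,\vec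 u_2)\|\le\alpha_k\,\epsilon\,\|\vec u_1-\vec u_2\|$ for all $k\in\mathbb N$ and all $\vec u_1,\vec u_2$ in the open ball of radius $\delta$ centered at $\vec x^*$. Then the set $$W^s(\mathcal A^*)=\Bigl\{\vec x_0\in\mathbb R^d:\ \lim_{k\to\infty}\vec x_k\ \text{exists and belongs to}\ \mathcal A^*\Bigr\}$$ of initial conditions whose orbit converges to a point of $\mathcal A^*$ has Lebesgue measure zero. -/

import Mathlib

open Filter Topology MeasureTheory

/-- The orbit `x₀, x₁, x₂, …` of the time non-homogeneous system `x_{k+1} = g (k, x_k)`. -/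
def tdOrbit {E : Type*} (g : ℕ → E → E) (x₀ : E) : ℕ → E
  | 0 => x₀
  | k + 1 => g k (tdOrbit g x₀ k)

/-- `z` is a fixed point of the system: `g (k, z) = z` for all `k`. -/
def IsTdFixedPoint {E : Type*} (g : ℕ → E → E) (z : E) : Prop :=
  ∀ k, g k z = z

/-- The global stable set of `A`: the initial conditions whose orbit converges to a point
of `A`. -/
def globalStableSet {E : Type*} [TopologicalSpace E] (g : ℕ → E → E) (A : Set E) : Set E :=
  {x₀ | ∃ z ∈ A, Tendsto (tdOrbit g x₀) atTop (𝓝 z)}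

/-- The fixed points `z` for which, for every `k`, the differential of `g (k, ·)` at `z` has an
eigenvalue (a complex root of its characteristic polynomial) of absolute value greater than
one. -/
def unstableFixedPoints {d : ℕ}
    (g : ℕ → EuclideanSpace ℝ (Fin d) → EuclideanSpace ℝ (Fin d)) :
    Set (EuclideanSpace ℝ (Fin d)) :=
  {z | IsTdFixedPoint g z ∧ ∀ k, ∃ μ : ℂ,
    Polynomial.aeval μ (LinearMap.charpoly (fderiv ℝ (g k) z).toLinearMap) = 0 ∧ 1 < ‖μ‖}

/-- A linear operator on `ℝ^d` is real diagonalizable if `ℝ^d` has a basis of eigenvectors. -/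
def IsRealDiagonalizable {d : ℕ}
    (G : EuclideanSpace ℝ (Fin d) →L[ℝ] EuclideanSpace ℝ (Fin d)) : Prop :=
  ∃ (b : Module.Basis (Fin d) ℝ (EuclideanSpace ℝ (Fin d))) (ev : Fin d → ℝ),
    ∀ i, G (b i) = ev i • b i

/-- The remainder `θ (k, x)` of the first order Taylor expansion of `g (k, ·)` at `z`. -/
noncomputable def taylorRem {d : ℕ}
    (g : ℕ → EuclideanSpace ℝ (Fin d) → EuclideanSpace ℝ (Fin d))
    (z : EuclideanSpace ℝ (Fin d)) (k : ℕ) (x : EuclideanSpace ℝ (Fin d)) :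
    EuclideanSpace ℝ (Fin d) :=
  g k x - g k z - fderiv ℝ (g k) z (x - z)

/-! No stable manifold is constructed. In eigencoordinates of `G` with the sup norm, the vectors
whose largest coordinate belongs to a negative eigenvalue form a cone. The difference of two orbits
near the fixed point that starts in this cone stays there and grows by a factor at least `1 + α k *
η` per step (`cone_step`). Since `∑ α k` diverges, it becomes unbounded (`not_bounded_of_cone`). So
the points whose orbit never leaves a small ball meet each line along an unstable eigenvector at
most once, and form a null set (`measure_eq_zero_of_line_subsingleton`). Almost everywhere
invertible differentials carry nullity back to time zero, and Lindelöf leaves countably many balls.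
-/

/-! ### Pulling null sets back along the dynamics -/

/-- The preimage of a null set under a `C¹` map whose differential is almost everywhere
invertible is a null set. -/
theorem measure_preimage_eq_zero_of_ae_det_fderiv_ne_zero {E : Type*} [NormedAddCommGroup E]
    [NormedSpace ℝ E] [FiniteDimensional ℝ E] [MeasurableSpace E] [BorelSpace E]
    (μ : Measure E) [μ.IsAddHaarMeasure] {f : E → E} (hf : ContDiff ℝ 1 f)
    (hdet : ∀ᵐ x ∂μ, (fderiv ℝ f x).det ≠ 0) {N : Set E} (hN : μ N = 0) :
    μ (f ⁻¹' N) = 0 := by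
  have hregular : μ (f ⁻¹' N ∩ {x | (fderiv ℝ f x).det ≠ 0}) = 0 := by
    refine measure_null_of_locally_null _ fun x hx => ?_
    have hstrict : HasStrictFDerivAt f
        ((fderiv ℝ f x).toContinuousLinearEquivOfDetNeZero hx.2 : E →L[ℝ] E) x := by
      rw [ContinuousLinearMap.coe_toContinuousLinearEquivOfDetNeZero]
      exact hf.contDiffAt.hasStrictFDerivAt one_ne_zero
    set φ := hstrict.toOpenPartialHomeomorph f
    have hinj : Set.InjOn f φ.source := φ.injOn
    have hopen : IsOpen φ.source := φ.open_source
    have hmem : x ∈ φ.source := hstrict.mem_toOpenPartialHomeomorph_source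
    -- `f` is injective on `A`, so the area formula equates the integral of `|det|` over `A` with `μ
    -- (f '' A) = 0`. The measurable hull of `N` makes `A` measurable.
    set A := φ.source ∩ f ⁻¹' toMeasurable μ N
    have hA : MeasurableSet A :=
      hopen.measurableSet.inter (hf.continuous.measurable (measurableSet_toMeasurable μ N))
    have himage : μ (f '' A) = 0 := by
      refine measure_mono_null ?_ ((measure_toMeasurable N).trans hN)
      rintro _ ⟨y, hy, rfl⟩
      exact hy.2
    have hint : ∫⁻ y in A, ENNReal.ofReal |(fderiv ℝ f y).det| ∂μ = 0 := by
      rw [lintegral_abs_det_fderiv_eq_addHaar_image μ hA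
        (fun y _ => ((hf.differentiable one_ne_zero) y).hasFDerivAt.hasFDerivWithinAt)
        (hinj.mono Set.inter_subset_left), himage]
    have hmeas : Measurable fun y => ENNReal.ofReal |(fderiv ℝ f y).det| :=
      ((ContinuousLinearMap.continuous_det.comp
        (hf.continuous_fderiv one_ne_zero)).abs.measurable).ennreal_ofReal
    have hA0 : μ A = 0 := by
      rw [lintegral_eq_zero_iff hmeas] at hint
      rw [← Measure.restrict_eq_zero, ← ae_eq_bot, ← eventually_false_iff_eq_bot]
      filter_upwards [hint, ae_restrict_of_ae hdet] with y hy hy'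
      simp only [Pi.zero_apply, ENNReal.ofReal_eq_zero] at hy
      exact hy' (abs_nonpos_iff.mp hy)
    refine ⟨A ∩ (f ⁻¹' N ∩ {x | (fderiv ℝ f x).det ≠ 0}), ?_,
      measure_mono_null Set.inter_subset_left hA0⟩
    refine mem_nhdsWithin.mpr ⟨φ.source, hopen, hmem, fun y hy => ⟨⟨hy.1, ?_⟩, hy.2⟩⟩
    exact subset_toMeasurable μ N hy.2.1
  refine measure_mono_null (fun x hx => ?_) (measure_union_null hregular (ae_iff.mp hdet))
  by_cases h : (fderiv ℝ f x).det = 0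
  · exact Or.inr (by simpa using h)
  · exact Or.inl ⟨hx, h⟩

theorem continuous_tdOrbit {E : Type*} [TopologicalSpace E] {g : ℕ → E → E}
    (hg : ∀ k, Continuous (g k)) (n : ℕ) : Continuous fun x => tdOrbit g x n := by
  induction n with
  | zero => exact continuous_id
  | succ n ih => exact (hg n).comp ih

theorem tdOrbit_add {E : Type*} (g : ℕ → E → E) (x : E) (K n : ℕ) :
    tdOrbit g x (K + n) = tdOrbit (fun k => g (K + k)) (tdOrbit g x K) n := by
  induction n with
  | zero => rfl
  | succ n ih => exact congrArg (g (K + n)) ih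

theorem measure_setOf_tdOrbit_mem_eq_zero {E : Type*} [NormedAddCommGroup E]
    [NormedSpace ℝ E] [FiniteDimensional ℝ E] [MeasurableSpace E] [BorelSpace E]
    (μ : Measure E) [μ.IsAddHaarMeasure] {g : ℕ → E → E} (hg : ∀ k, ContDiff ℝ 1 (g k))
    (hdet : ∀ k, ∀ᵐ x ∂μ, (fderiv ℝ (g k) x).det ≠ 0) (n : ℕ) {N : Set E} (hN : μ N = 0) :
    μ {x | tdOrbit g x n ∈ N} = 0 := by
  induction n generalizing N with
  | zero => exact hN
  | succ n ih =>
    exact ih (measure_preimage_eq_zero_of_ae_det_fderiv_ne_zero μ (hg n) (hdet n) hN)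

/-! ### Expansion in the unstable cone -/

/-- A perturbation of the diagonal map `1 - a • diag ev` preserves the cone of the vectors whose
largest coordinate has a negative entry of `ev`, and expands the sup norm on this cone. -/
theorem cone_step {ι : Type*} [Fintype ι] {ev : ι → ℝ} {a η : ℝ} (ha : 0 < a)
    (hneg : ∀ i, ev i < 0 → 2 * η ≤ -ev i) (hsmall : ∀ i, a * ev i ≤ 1) {w w' : ι → ℝ}
    (hw' : ∀ i, |w' i - (1 - a * ev i) * w i| ≤ a * η * ‖w‖)
    (hw : ∃ j, ev j < 0 ∧ |w j| = ‖w‖) :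
    (∃ j, ev j < 0 ∧ |w' j| = ‖w'‖) ∧ (1 + a * η) * ‖w‖ ≤ ‖w'‖ := by
  obtain ⟨j, hj, hjw⟩ := hw
  have hle (v : ι → ℝ) (i : ι) : |v i| ≤ ‖v‖ := norm_le_pi_norm v i
  have hgrow : (1 + a * η) * ‖w‖ ≤ |w' j| := by
    have h1 : |(1 - a * ev j) * w j| = (1 - a * ev j) * ‖w‖ := by
      rw [abs_mul, hjw, abs_of_nonneg (by linarith [hsmall j])]
    have h2 := abs_sub_abs_le_abs_sub ((1 - a * ev j) * w j) (w' j)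
    rw [abs_sub_comm, h1] at h2
    -- The linear part gains at least `2 * a * η`; the perturbation costs at most `a * η`.
    have h3 : a * (2 * η) * ‖w‖ ≤ a * (-ev j) * ‖w‖ := by
      gcongr
      exact hneg j hj
    linarith [hw' j]
  refine ⟨?_, hgrow.trans (hle w' j)⟩
  have : Nonempty ι := ⟨j⟩
  obtain ⟨i, hi⟩ := Finite.exists_max fun i => |w' i|
  have hmax (l : ι) (hl : ∀ i, |w' i| ≤ |w' l|) : |w' l| = ‖w'‖ :=
    le_antisymm (hle w' l) ((pi_norm_le_iff_of_nonneg (abs_nonneg _)).mpr hl)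
  by_cases hneg_i : ev i < 0
  · exact ⟨i, hneg_i, hmax i hi⟩
  -- A coordinate with `ev i ≥ 0` is at most `(1 + a * η) * ‖w‖`, hence at most `|w' j|`, so `j`
  -- also attains the maximum.
  · refine ⟨j, hj, hmax j fun l => (hi l).trans ?_⟩
    refine le_trans ?_ hgrow
    have h1 : |(1 - a * ev i) * w i| ≤ ‖w‖ := by
      rw [abs_mul, abs_of_nonneg (by linarith [hsmall i])]
      have : 0 ≤ a * ev i := mul_nonneg ha.le (not_lt.mp hneg_i)
      nlinarith [hle w i, abs_nonneg (w i)]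
    have h2 := abs_sub_abs_le_abs_sub (w' i) ((1 - a * ev i) * w i)
    linarith [hw' i]

theorem repr_apply_of_apply_basis_eq_smul {ι R M : Type*} [CommRing R] [AddCommGroup M]
    [Module R M] (b : Module.Basis ι R M) {ev : ι → R} {G : Module.End R M}
    (hG : ∀ i, G (b i) = ev i • b i) (x : M) (i : ι) : b.repr (G x) i = ev i * b.repr x i := by
  have : b.coord i ∘ₗ G = ev i • b.coord i := by
    refine b.ext fun l => ?_
    by_cases h : l = i
    · subst h; simp [hG]
    · simp [hG, h]
  simpa using LinearMap.congr_fun this x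

theorem exists_eq_of_hasEigenvalue {ι R M : Type*} [Field R] [AddCommGroup M]
    [Module R M] (b : Module.Basis ι R M) {ev : ι → R} {G : Module.End R M}
    (hG : ∀ i, G (b i) = ev i • b i) {c : R} (hc : G.HasEigenvalue c) : ∃ i, ev i = c := by
  obtain ⟨x, hx⟩ := hc.exists_hasEigenvector
  by_contra! hne
  refine hx.2 (b.repr.map_eq_zero_iff.mp (Finsupp.ext fun i => ?_))
  have h := repr_apply_of_apply_basis_eq_smul b hG x i
  rw [hx.apply_eq_smul] at h
  simp only [map_smul, Finsupp.smul_apply, smul_eq_mul] at h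
  exact (mul_eq_mul_right_iff.mp h).resolve_left (hne i).symm

theorem not_summable_of_one_div_isBigO {α : ℕ → ℝ}
    (hα : (fun k : ℕ => 1 / (k : ℝ)) =O[atTop] α) : ¬ Summable α := fun h =>
  Real.not_summable_one_div_natCast (summable_of_isBigO_nat h hα)

/-- A sequence of vectors in the unstable cone of the linear part is unbounded. -/
theorem not_bounded_of_cone {ι : Type*} [Fintype ι] {ev : ι → ℝ} {a : ℕ → ℝ} {η : ℝ}
    (ha : ∀ k, 0 < a k) (hη : 0 < η) (hsum : ¬ Summable a)
    (hneg : ∀ i, ev i < 0 → 2 * η ≤ -ev i) (hsmall : ∀ k i, a k * ev i ≤ 1) {w : ℕ → ι → ℝ}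
    (hw : ∀ k i, |w (k + 1) i - (1 - a k * ev i) * w k i| ≤ a k * η * ‖w k‖)
    (h0 : ∃ j, ev j < 0 ∧ |w 0 j| = ‖w 0‖) (hne : w 0 ≠ 0) (C : ℝ) :
    ∃ k, C < ‖w k‖ := by
  have hcone (k : ℕ) : ∃ j, ev j < 0 ∧ |w k j| = ‖w k‖ := by
    induction k with
    | zero => exact h0
    | succ k ih => exact (cone_step (ha k) hneg (hsmall k) (hw k) ih).1
  have hstep (k : ℕ) : (1 + a k * η) * ‖w k‖ ≤ ‖w (k + 1)‖ :=
    (cone_step (ha k) hneg (hsmall k) (hw k) (hcone k)).2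
  have hpos : 0 < ‖w 0‖ := norm_pos_iff.mpr hne
  have hmono (k : ℕ) : ‖w 0‖ ≤ ‖w k‖ := by
    induction k with
    | zero => exact le_rfl
    | succ k ih => nlinarith [hstep k, mul_nonneg (mul_pos (ha k) hη).le (norm_nonneg (w k))]
  -- A linear lower bound replaces the product of the factors `1 + a k * η`, so divergence of the
  -- sum suffices.
  have hgrow (n : ℕ) : η * ‖w 0‖ * ∑ k ∈ Finset.range n, a k ≤ ‖w n‖ := by
    induction n with
    | zero => simp
    | succ n ih =>
      rw [Finset.sum_range_succ]
      have := mul_le_mul_of_nonneg_left (hmono n) (mul_pos (ha n) hη).le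
      nlinarith [hstep n]
  by_contra! hC
  refine hsum (summable_of_sum_range_le (c := C / (η * ‖w 0‖)) (fun k => (ha k).le) fun n => ?_)
  rw [le_div_iff₀ (mul_pos hη hpos), mul_comm]
  exact (hgrow n).trans (hC n)

/-- If two orbits of a perturbation of `1 - a k • G` stay in a common ball, then their difference
at time zero is not a multiple of an eigenvector of `G` with negative eigenvalue. -/
theorem eq_zero_of_tdOrbit_mem_ball {E ι : Type*} [NormedAddCommGroup E] [NormedSpace ℝ E]
    [Fintype ι] (e : E ≃L[ℝ] (ι → ℝ)) {ev : ι → ℝ} {G : E →L[ℝ] E}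
    (hG : ∀ x i, e (G x) i = ev i * e x i) {a : ℕ → ℝ} {η ε δ : ℝ} {z : E}
    (ha : ∀ k, 0 < a k) (hη : 0 < η) (hsum : ¬ Summable a)
    (hneg : ∀ i, ev i < 0 → 2 * η ≤ -ev i) (hsmall : ∀ k i, a k * ev i ≤ 1)
    (hε : 0 ≤ ε) (hεη : ‖(e : E →L[ℝ] (ι → ℝ))‖ * ε * ‖(e.symm : (ι → ℝ) →L[ℝ] E)‖ ≤ η)
    {g : ℕ → E → E}
    (hrem : ∀ k, ∀ u ∈ Metric.ball z δ, ∀ v ∈ Metric.ball z δ,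
      ‖g k u - g k v - (u - v - a k • G (u - v))‖ ≤ a k * ε * ‖u - v‖)
    {x y : E} (hx : ∀ n, tdOrbit g x n ∈ Metric.ball z δ)
    (hy : ∀ n, tdOrbit g y n ∈ Metric.ball z δ) {j : ι} (hj : ev j < 0)
    (hmax : |e (x - y) j| = ‖e (x - y)‖) : x = y := by
  by_contra hxy
  set w : ℕ → ι → ℝ := fun n => e (tdOrbit g x n - tdOrbit g y n) with hw
  have hstep (k : ℕ) (i : ι) :
      |w (k + 1) i - (1 - a k * ev i) * w k i| ≤ a k * η * ‖w k‖ := by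
    set u := tdOrbit g x k
    set v := tdOrbit g y k
    have h1 : w (k + 1) i - (1 - a k * ev i) * w k i
        = e (g k u - g k v - (u - v - a k • G (u - v))) i := by
      change e (g k u - g k v) i - (1 - a k * ev i) * e (u - v) i = _
      rw [map_sub e (g k u - g k v), map_sub e (u - v), map_smul]
      simp only [Pi.sub_apply, Pi.smul_apply, smul_eq_mul, hG]
      ring
    have h2 : ‖u - v‖ ≤ ‖(e.symm : (ι → ℝ) →L[ℝ] E)‖ * ‖w k‖ := by
      have := (e.symm : (ι → ℝ) →L[ℝ] E).le_opNorm (w k)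
      simpa [hw] using this
    rw [h1]
    calc |e (g k u - g k v - (u - v - a k • G (u - v))) i|
        ≤ ‖e (g k u - g k v - (u - v - a k • G (u - v)))‖ := norm_le_pi_norm (e _) i
      _ ≤ ‖(e : E →L[ℝ] (ι → ℝ))‖ * ‖g k u - g k v - (u - v - a k • G (u - v))‖ :=
          (e : E →L[ℝ] (ι → ℝ)).le_opNorm _
      _ ≤ ‖(e : E →L[ℝ] (ι → ℝ))‖ *
          (a k * ε * (‖(e.symm : (ι → ℝ) →L[ℝ] E)‖ * ‖w k‖)) := by
          have := (ha k).le
          gcongr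
          exact (hrem k u (hx k) v (hy k)).trans (by gcongr)
      _ = a k * (‖(e : E →L[ℝ] (ι → ℝ))‖ * ε * ‖(e.symm : (ι → ℝ) →L[ℝ] E)‖) * ‖w k‖ := by
          ring
      _ ≤ a k * η * ‖w k‖ := by
          have := (ha k).le
          gcongr
  obtain ⟨k, hk⟩ := not_bounded_of_cone ha hη hsum hneg hsmall hstep ⟨j, hj, hmax⟩
    (by simpa [hw, sub_eq_zero, tdOrbit] using hxy) (‖(e : E →L[ℝ] (ι → ℝ))‖ * (δ + δ))
  refine hk.not_ge (((e : E →L[ℝ] (ι → ℝ)).le_opNorm _).trans ?_)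
  gcongr
  rw [← dist_eq_norm]
  exact (dist_triangle_right _ _ z).trans
    (add_le_add (Metric.mem_ball.mp (hx k)).le (Metric.mem_ball.mp (hy k)).le)

/-! ### Nullity of the trapped set near a fixed point -/

/-- A measurable set that meets each line parallel to `v` in at most one point is null. -/
theorem measure_eq_zero_of_line_subsingleton {E : Type*} [NormedAddCommGroup E]
    [NormedSpace ℝ E] [FiniteDimensional ℝ E] [MeasurableSpace E] [BorelSpace E]
    (μ : Measure E) [μ.IsAddHaarMeasure] {s : Set E} (hs : MeasurableSet s) (v : E)
    (hline : ∀ x ∈ s, ∀ t : ℝ, x + t • v ∈ s → t = 0) : μ s = 0 := by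
  have hinv (n : ℕ) : ‖(1 / ((n : ℝ) + 1))‖ ≤ 1 := by
    rw [Real.norm_of_nonneg (by positivity), div_le_one (by positivity)]
    linarith [n.cast_nonneg (α := ℝ)]
  -- The translates of `s` by `v / (n + 1)` are infinitely many, boundedly displaced and pairwise
  -- disjoint.
  refine Measure.addHaar_eq_zero_of_disjoint_translates μ
    (u := fun n : ℕ => (1 / ((n : ℝ) + 1)) • v) ?_ ?_ hs
  · refine isBounded_iff_forall_norm_le.mpr ⟨‖v‖, ?_⟩
    rintro _ ⟨n, rfl⟩
    rw [norm_smul]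
    exact mul_le_of_le_one_left (norm_nonneg v) (hinv n)
  · intro m n hmn
    rw [Function.onFun, Set.disjoint_left]
    rintro _ ⟨_, rfl, x, hx, rfl⟩ ⟨_, rfl, y, hy, hxy⟩
    refine hmn ?_
    have hxy' : y = x + (1 / ((m : ℝ) + 1) - 1 / ((n : ℝ) + 1)) • v := by
      simp only at hxy
      rw [sub_smul, ← add_sub_assoc, eq_sub_iff_add_eq, add_comm, hxy, add_comm]
    have := hline x hx _ (hxy' ▸ hy)
    rw [sub_eq_zero, one_div, one_div, inv_inj, add_left_inj] at this
    exact_mod_cast this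

/-- Near an unstable fixed point, the orbits which stay in a suitable ball from some large time
onwards start, at that time, in a null set. -/
theorem exists_ball_measure_eq_zero {E ι : Type*} [NormedAddCommGroup E] [NormedSpace ℝ E]
    [FiniteDimensional ℝ E] [MeasurableSpace E] [BorelSpace E] (μ : Measure E)
    [μ.IsAddHaarMeasure] [Fintype ι] {α : ℕ → ℝ} (hα_pos : ∀ k, 0 < α k)
    (hα_lim : Tendsto α atTop (𝓝 0)) (hsum : ¬ Summable α) {g : ℕ → E → E}
    (hg : ∀ k, Continuous (g k)) {z : E} {G : E →L[ℝ] E} (b : Module.Basis ι ℝ E) {ev : ι → ℝ}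
    (hb : ∀ i, G (b i) = ev i • b i) (hex : ∃ j, ev j < 0)
    (hrem : ∀ ε : ℝ, 0 < ε → ∃ δ : ℝ, 0 < δ ∧ ∀ k,
      ∀ u ∈ Metric.ball z δ, ∀ v ∈ Metric.ball z δ,
        ‖g k u - g k v - (u - v - α k • G (u - v))‖ ≤ α k * ε * ‖u - v‖) :
    ∃ δ : ℝ, 0 < δ ∧ ∃ K₀, ∀ K ≥ K₀,
      μ {x | ∀ n, tdOrbit (fun k => g (K + k)) x n ∈ Metric.ball z δ} = 0 := by
  classical
  set e : E ≃L[ℝ] (ι → ℝ) := b.equivFunL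
  have hG (x : E) (i : ι) : e (G x) i = ev i * e x i := by
    simpa [e] using repr_apply_of_apply_basis_eq_smul b (G := G.toLinearMap) hb x i
  obtain ⟨η, hneg, hη⟩ : ∃ η : ℝ, (∀ i, ev i < 0 → 2 * η ≤ -ev i) ∧ 0 < η := by
    have h : ∀ᶠ η : ℝ in 𝓝[>] 0, ∀ i, ev i < 0 → 2 * η ≤ -ev i := by
      refine eventually_nhdsWithin_of_eventually_nhds (eventually_all.mpr fun i => ?_)
      by_cases hi : ev i < 0
      · filter_upwards [eventually_lt_nhds (show (0 : ℝ) < -ev i / 2 by linarith)] with η hη _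
        linarith
      · exact Eventually.of_forall fun η h => absurd h hi
    exact (h.and self_mem_nhdsWithin).exists
  -- From time `K₀` on, the diagonal entries `1 - α k * ev i` are nonnegative.
  obtain ⟨K₀, hK₀⟩ : ∃ K₀, ∀ k ≥ K₀, ∀ i, α k * ev i ≤ 1 := by
    refine eventually_atTop.mp (eventually_all.mpr fun i => ?_)
    have : Tendsto (fun k => α k * ev i) atTop (𝓝 0) := by simpa using hα_lim.mul_const (ev i)
    exact (this.eventually_lt_const one_pos).mono fun k hk => hk.le
  set C := ‖(e : E →L[ℝ] (ι → ℝ))‖ * ‖(e.symm : (ι → ℝ) →L[ℝ] E)‖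
  have hC : 0 ≤ C := by positivity
  -- `C` is the cost of passing to eigencoordinates and back; the `+ 1` spares a proof that `C ≠ 0`.
  have hε : 0 < η / (C + 1) := by positivity
  have hεη : ‖(e : E →L[ℝ] (ι → ℝ))‖ * (η / (C + 1)) * ‖(e.symm : (ι → ℝ) →L[ℝ] E)‖ ≤ η := by
    calc _ = C * η / (C + 1) := by ring
      _ ≤ η := by rw [div_le_iff₀ (by positivity)]; nlinarith
  obtain ⟨δ, hδ, hrem⟩ := hrem _ hε
  refine ⟨δ, hδ, K₀, fun K hK => ?_⟩
  obtain ⟨j, hj⟩ := hex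
  refine measure_eq_zero_of_line_subsingleton μ ?_ (b j) fun x hx t hxt => ?_
  · rw [Set.ofPred_forall]
    exact MeasurableSet.iInter fun n =>
      (continuous_tdOrbit (fun k => hg (K + k)) n).measurable measurableSet_ball
  · have heq : x + t • b j = x := by
      refine eq_zero_of_tdOrbit_mem_ball e hG (fun k => hα_pos (K + k)) hη
        (fun h => hsum ((summable_nat_add_iff K).mp (by simpa [add_comm] using h))) hneg
        (fun k => hK₀ (K + k) (by omega)) hε.le hεη (fun k => hrem (K + k)) hxt hx hj ?_
      have : e (x + t • b j - x) = Pi.single j t := by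
        ext i
        simp [e, Finsupp.single_apply, Pi.single_apply, eq_comm]
      rw [this, Pi.norm_single, Pi.single_eq_same, Real.norm_eq_abs]
    exact (smul_eq_zero.mp (add_eq_left.mp heq)).resolve_right (b.ne_zero j)

/-! ### From local to global -/

theorem corollary4p3 (d : ℕ) (α : ℕ → ℝ)
    (hα_pos : ∀ k, 0 < α k)
    (hα_lim : Tendsto α atTop (𝓝 0))
    (hα_omega : (fun k : ℕ => 1 / (k : ℝ)) =O[atTop] α)
    (g : ℕ → EuclideanSpace ℝ (Fin d) → EuclideanSpace ℝ (Fin d))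
    (hg : ∀ k, ContDiff ℝ 1 (g k))
    (hg_nonsing : ∀ k, ∀ᵐ x ∂volume, (fderiv ℝ (g k) x).det ≠ 0)
    (h_lin : ∀ z ∈ unstableFixedPoints g,
      ∃ G : EuclideanSpace ℝ (Fin d) →L[ℝ] EuclideanSpace ℝ (Fin d),
        IsRealDiagonalizable G ∧
        (∃ lam : ℝ, lam < 0 ∧ Module.End.HasEigenvalue G.toLinearMap lam) ∧
        ∀ k, fderiv ℝ (g k) z = ContinuousLinearMap.id ℝ _ - α k • G)
    (h_rem : ∀ z ∈ unstableFixedPoints g, ∀ ε : ℝ, 0 < ε → ∃ δ : ℝ, 0 < δ ∧ ∀ k,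
      ∀ u₁ ∈ Metric.ball z δ, ∀ u₂ ∈ Metric.ball z δ,
        ‖taylorRem g z k u₁ - taylorRem g z k u₂‖ ≤ α k * ε * ‖u₁ - u₂‖) :
    volume (globalStableSet g (unstableFixedPoints g)) = 0 := by
  have hlocal : ∀ z ∈ unstableFixedPoints g, ∃ δ : ℝ, 0 < δ ∧ ∃ K₀, ∀ K ≥ K₀,
      volume {x | ∀ n, tdOrbit (fun k => g (K + k)) x n ∈ Metric.ball z δ} = 0 := by
    intro z hz
    obtain ⟨G, ⟨b, ev, hb⟩, ⟨lam, hlam, hev⟩, hG⟩ := h_lin z hz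
    obtain ⟨j, hj⟩ := exists_eq_of_hasEigenvalue b hb hev
    refine exists_ball_measure_eq_zero volume hα_pos hα_lim
      (not_summable_of_one_div_isBigO hα_omega) (fun k => (hg k).continuous) b hb
      ⟨j, hj ▸ hlam⟩ fun ε hε => ?_
    obtain ⟨δ, hδ, h⟩ := h_rem z hz ε hε
    refine ⟨δ, hδ, fun k u hu v hv => ?_⟩
    have heq : g k u - g k v - (u - v - α k • G (u - v)) =
        taylorRem g z k u - taylorRem g z k v := by
      simp only [taylorRem, hG, sub_apply, ContinuousLinearMap.id_apply, smul_apply, map_sub,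
        smul_sub]
      abel
    exact heq ▸ h k u hu v hv
  choose! δ hδ K₀ hnull using hlocal
  -- The unstable fixed points may be uncountable; countably many of the balls cover them.
  obtain ⟨t, htA, ht, hcover⟩ := TopologicalSpace.countable_cover_nhdsWithin
    fun z hz => mem_nhdsWithin_of_mem_nhds (Metric.ball_mem_nhds z (hδ z hz))
  -- The time `K₀ z + m` is late enough both for the local result and for the orbit to have entered
  -- the ball for good.
  have hsub : globalStableSet g (unstableFixedPoints g) ⊆
      ⋃ z ∈ t, ⋃ m : ℕ, {x₀ | tdOrbit g x₀ (K₀ z + m) ∈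
        {x | ∀ n, tdOrbit (fun k => g (K₀ z + m + k)) x n ∈ Metric.ball z (δ z)}} := by
    rintro x₀ ⟨y, hy, hlim⟩
    obtain ⟨z, hzt, hyz⟩ := Set.mem_iUnion₂.mp (hcover hy)
    obtain ⟨m, hm⟩ := eventually_atTop.mp (hlim.eventually (Metric.isOpen_ball.mem_nhds hyz))
    refine Set.mem_iUnion₂.mpr ⟨z, hzt, Set.mem_iUnion.mpr ⟨m, fun n => ?_⟩⟩
    rw [← tdOrbit_add]
    exact hm _ (by omega)
  refine measure_mono_null hsub ((measure_biUnion_null_iff ht).mpr fun z hz =>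
    measure_iUnion_null fun m => ?_)
  exact measure_setOf_tdOrbit_mem_eq_zero volume hg hg_nonsing _
    (hnull z (htA hz) _ (Nat.le_add_right _ _))
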